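/- Let $\mathbb K\in\{\mathbb R,\mathbb C\}$, let $A\in\mathbb K^{N\times n}$ have rows $a_1,\dots,a_N$, let $0\ne w\in\mathbb K^n$, and write $\langle u,v\rangle=\sum_i u_iv_i$. Let $b=Ax+\varepsilon$, where $x\in\mathbb K^n$ is an unknown parameter and the noise $\varepsilon$ is a centered multivariate Gaussian vector in $\mathbb K^N$ (circularly symmetric if $\mathbb K=\mathbb C$), possibly degenerate, with covariance matrix $\Sigma=\mathbb E(\bar\varepsilon\,\varepsilon^\top)$. *Circuits and divisors.* A set $C\subseteq[N]$ is a *particular circuit* if $w=\sum_{i\in C}\lambda_ia_i$ has a solution and every solution has all $\lambda_i\neq0$; it is a *general circuit* if $0=\sum_{i\in C}\lambda_ia_i$ has a nonzero solution and every nonzero solution has all $\lambda_i\ne0$. Its circuit vector $\lambda_C\in\mathbb K^N$ is the solution, extended by zero (unique in the particular case; a fixed solution of norm one in the general case). A *divisor* is a formal $\mathbb K$-linear combination $D=\sum_j\alpha_jC_j$ of circuits, with vector $\lambda_D=\sum_j\alpha_j\lambda_{C_j}$; $D\sim D'$ means $\lambda_D=\lambda_{D'}$. For $I\subseteq[N]$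 let $\mathcal L(I)$ be the set of all $D\sim C+D'$ with $C\subseteq I$ a particular circuit and $D'$ a linear combination of general circuits contained in $I$. A *particular system* is a nonempty affine space $\mathcal L\subseteq\mathcal L([N])$ of divisors that is closed under $\sim$. A *support* $\operatorname{supp}\mathcal L$ of $\mathcal L$ is an inclusion-maximal set $I\subseteq[N]$ with $\mathcal L(I)\subseteq\mathcal L$. *Theorem.* Let $\mathcal L$ be a particular system with support $I=\operatorname{supp}\mathcal L$. Then the quadratic form $k(D,D)=\lambda_D^*\Sigma\lambda_D$ attains its minimum on $\mathcal L$. Let $D\in\mathcal L$ be any minimizer and $\widehat\gamma(\mathcal L)=\langle\lambda_D,b\rangle$, and suppose that $\widehat\gamma(\mathcal L)$ is a function of the observations $b_I=(b_i)_{i\in I}$, that is, $\lambda_D$ vanishes outside $I$ (as is always the case when $\mathcal L=\mathcal L(I)$). Then, for the family of laws of $b_I$ indexed by $x\in\mathbb K^n$: 1. $\widehat\gamma(\mathcal L)$ is a complete statistic: if $g$ is measurable and $\mathbb E_x\,g(\widehat\gamma(\mathcal L))$ exists and is $0$ for all $x$, then $g(\widehat\gamma(\mathcal L))=0$ almost surely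 for all $x$. 2. $\widehat\gamma(\mathcal L)$ is a sufficient statistic for the parameter $\langle w,x\rangle$, the remaining part of $x$ being a nuisance parameter (Fraser's sufficiency, or S-sufficiency): the law of $\widehat\gamma(\mathcal L)$ depends on $x$ only through $\langle w,x\rangle$, and there is a linear map $\eta:\mathbb K^n\to\ker\langle w,\cdot\rangle$ such that $x\mapsto(\langle w,x\rangle,\eta(x))$ is a bijection onto $\mathbb K\times\ker\langle w,\cdot\rangle$ and, for each fixed value of $\eta(x)$, the conditional law of $b_I$ given $\widehat\gamma(\mathcal L)$ does not depend on $\langle w,x\rangle$. 3. $\widehat\gamma(\mathcal L)$ is the minimum variance unbiased estimator of $\langle w,x\rangle$ from $b_I$: it is unbiased, for every $x$ its variance is at most that of any estimator $U(b_I)$ that is unbiased for all $x$, and any other minimum variance unbiased estimator is almost surely equal to it, for every $x$. -/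

import Mathlib

open MeasureTheory ProbabilityTheory
open scoped Matrix ENNReal

noncomputable section

namespace MatroidRegression

/-! ### Regression circuits and circuit divisors -/

section Circuits

variable {𝕜 : Type*} [RCLike 𝕜] {N n : ℕ}

/-- `C` is a particular regression circuit: `w = ∑ i ∈ C, l i • a i` is solvable, and every
solution has all its coefficients on `C` nonzero. Here `a i` is the `i`-th row of `A`. -/
def IsParticularCircuit (A : Matrix (Fin N) (Fin n) 𝕜) (w : Fin n → 𝕜)
    (C : Finset (Fin N)) : Prop :=
  (∃ l : Fin N → 𝕜, (∀ i ∉ C, l i = 0) ∧ l ᵥ* A = w) ∧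
    ∀ l : Fin N → 𝕜, (∀ i ∉ C, l i = 0) → l ᵥ* A = w → ∀ i ∈ C, l i ≠ 0

/-- `C` is a general regression circuit: the rows indexed by `C` have a nontrivial linear
relation, and every nontrivial relation has all its coefficients on `C` nonzero. -/
def IsGeneralCircuit (A : Matrix (Fin N) (Fin n) 𝕜) (C : Finset (Fin N)) : Prop :=
  (∃ l : Fin N → 𝕜, l ≠ 0 ∧ (∀ i ∉ C, l i = 0) ∧ l ᵥ* A = 0) ∧
    ∀ l : Fin N → 𝕜, l ≠ 0 → (∀ i ∉ C, l i = 0) → l ᵥ* A = 0 → ∀ i ∈ C, l i ≠ 0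

/-- The circuits, of either type, of the regression matroid of `A` and `w`. -/
def Circuit (A : Matrix (Fin N) (Fin n) 𝕜) (w : Fin n → 𝕜) : Type :=
  {C : Finset (Fin N) // IsParticularCircuit A w C ∨ IsGeneralCircuit A C}

/-- `l` represents the circuit `C`: the solution of `l A = w` on `C` if `C` is particular,
a normed solution of `l A = 0` on `C` if `C` is general. -/
def IsCircuitVector (A : Matrix (Fin N) (Fin n) 𝕜) (w : Fin n → 𝕜)
    (C : Finset (Fin N)) (l : Fin N → 𝕜) : Prop :=
  (∀ i ∉ C, l i = 0) ∧
    ((IsParticularCircuit A w C ∧ l ᵥ* A = w) ∨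
      (IsGeneralCircuit A C ∧ l ᵥ* A = 0 ∧ ∑ i, ‖l i‖ ^ 2 = 1))

theorem exists_isCircuitVector {A : Matrix (Fin N) (Fin n) 𝕜} {w : Fin n → 𝕜}
    (C : Circuit A w) : ∃ l, IsCircuitVector A w C.1 l := by
  rcases C.2 with h | h
  · obtain ⟨l, h0, h1⟩ := h.1
    exact ⟨l, h0, Or.inl ⟨h, h1⟩⟩
  · obtain ⟨l, hne, h0, h1⟩ := h.1
    have hpos : 0 < ∑ i, ‖l i‖ ^ 2 := by
      obtain ⟨i, hi⟩ := Function.ne_iff.mp hne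
      have hi' : 0 < ‖l i‖ := norm_pos_iff.mpr hi
      exact Finset.sum_pos' (fun j _ => by positivity) ⟨i, Finset.mem_univ i, by positivity⟩
    refine ⟨((((Real.sqrt (∑ i, ‖l i‖ ^ 2))⁻¹ : ℝ) : 𝕜)) • l, ?_, Or.inr ⟨h, ?_, ?_⟩⟩
    · intro i hi
      simp [h0 i hi]
    · rw [Matrix.smul_vecMul, h1, smul_zero]
    · simp only [Pi.smul_apply, smul_eq_mul, norm_mul, mul_pow, ← Finset.mul_sum,
        RCLike.norm_ofReal, sq_abs, inv_pow]
      rw [Real.sq_sqrt hpos.le]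
      exact inv_mul_cancel₀ hpos.ne'

/-- The circuit vector of a circuit (unique for a particular circuit). -/
def circuitVector {A : Matrix (Fin N) (Fin n) 𝕜} {w : Fin n → 𝕜} (C : Circuit A w) :
    Fin N → 𝕜 :=
  Classical.choose (exists_isCircuitVector C)

/-- Circuit divisors: formal linear combinations of circuits. -/
abbrev Divisor (A : Matrix (Fin N) (Fin n) 𝕜) (w : Fin n → 𝕜) : Type _ :=
  Circuit A w →₀ 𝕜

/-- The circuit vector of a circuit divisor. -/
def divisorVector {A : Matrix (Fin N) (Fin n) 𝕜} {w : Fin n → 𝕜} :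
    Divisor A w →ₗ[𝕜] (Fin N → 𝕜) :=
  Finsupp.linearCombination 𝕜 circuitVector

/-- Linear equivalence of divisors: equality of circuit vectors. -/
def LinEquivalent {A : Matrix (Fin N) (Fin n) 𝕜} {w : Fin n → 𝕜} (D₁ D₂ : Divisor A w) : Prop :=
  divisorVector D₁ = divisorVector D₂

/-- The span of the general circuits contained in `I`. -/
def generalSystemOn (A : Matrix (Fin N) (Fin n) 𝕜) (w : Fin n → 𝕜) (I : Finset (Fin N)) :
    Submodule 𝕜 (Divisor A w) :=
  Submodule.span 𝕜
    {D | ∃ C : Circuit A w, IsGeneralCircuit A C.1 ∧ C.1 ⊆ I ∧ D = Finsupp.single C 1}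

/-- The particular system `𝓛(I)`: all divisors linearly equivalent to the sum of a particular
circuit contained in `I` and a general divisor on general circuits contained in `I`. -/
def particularSystemOn (A : Matrix (Fin N) (Fin n) 𝕜) (w : Fin n → 𝕜) (I : Finset (Fin N)) :
    Set (Divisor A w) :=
  {D | ∃ C : Circuit A w, IsParticularCircuit A w C.1 ∧ C.1 ⊆ I ∧
    ∃ D' ∈ generalSystemOn A w I, LinEquivalent D (Finsupp.single C 1 + D')}

/-- The regression space, whose elements are the particular regression divisors. -/
def regressionSpace (A : Matrix (Fin N) (Fin n) 𝕜) (w : Fin n → 𝕜) : Set (Divisor A w) :=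
  particularSystemOn A w Finset.univ

/-- Particular systems: (nonempty) affine spaces of particular regression divisors, closed under
linear equivalence. -/
structure IsParticularSystem {A : Matrix (Fin N) (Fin n) 𝕜} {w : Fin n → 𝕜}
    (L : AffineSubspace 𝕜 (Divisor A w)) : Prop where
  nonempty : (L : Set (Divisor A w)).Nonempty
  subset : (L : Set (Divisor A w)) ⊆ regressionSpace A w
  closed : ∀ D₁ ∈ L, ∀ D₂, LinEquivalent D₁ D₂ → D₂ ∈ L

/-- `I` is a support of the particular system `L`: an inclusion-wise maximal set of rows such that
`L` contains `𝓛(I)`. -/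
def IsSupport {A : Matrix (Fin N) (Fin n) 𝕜} {w : Fin n → 𝕜}
    (L : AffineSubspace 𝕜 (Divisor A w)) (I : Finset (Fin N)) : Prop :=
  Maximal (fun J : Finset (Fin N) => particularSystemOn A w J ⊆ (L : Set (Divisor A w))) I

end Circuits

/-! ### Noise, circuit kernel, and the estimator -/

section Estimator

variable {𝕜 : Type*} [RCLike 𝕜] {N n : ℕ}

/-- Centered multivariate Gaussian law on `𝕜 ^ N`. For `𝕜 = ℝ` the last field is void; for `𝕜 = ℂ`
(where `RCLike.I ≠ 0`) it says that the pseudo-covariance vanishes, i.e. that the law is a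
circularly symmetric complex Gaussian. -/
structure IsGaussianNoise (μ : Measure (Fin N → 𝕜)) : Prop where
  gaussian : IsGaussian μ
  centered : ∀ i, ∫ e, e i ∂μ = 0
  circular : (RCLike.I : 𝕜) ≠ 0 → ∀ i j, ∫ e, e i * e j ∂μ = 0

/-- Covariance matrix of centered noise, with the conjugate on the first factor, so that
`l* Σ l` is the variance of the evaluation `∑ i, l i * ε i`. -/
def noiseCov (μ : Measure (Fin N → 𝕜)) : Matrix (Fin N) (Fin N) 𝕜 :=
  Matrix.of fun i j => ∫ e, star (e i) * e j ∂μ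

/-- The circuit kernel `k(D₁, D₂) = λ₁* Σ λ₂`. -/
def circuitKernel {A : Matrix (Fin N) (Fin n) 𝕜} {w : Fin n → 𝕜}
    (S : Matrix (Fin N) (Fin N) 𝕜) (D₁ D₂ : Divisor A w) : 𝕜 :=
  star (divisorVector D₁) ⬝ᵥ (S *ᵥ divisorVector D₂)

/-- `D` minimizes `k(D, D)` over `L`. -/
def IsKernelMinimizer {A : Matrix (Fin N) (Fin n) 𝕜} {w : Fin n → 𝕜}
    (S : Matrix (Fin N) (Fin N) 𝕜) (L : AffineSubspace 𝕜 (Divisor A w)) (D : Divisor A w) : Prop :=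
  D ∈ L ∧ ∀ D' ∈ L, RCLike.re (circuitKernel S D D) ≤ RCLike.re (circuitKernel S D' D')

/-- The law of the observations `(b i)`, `i ∈ I`, where `b = A x + ε` and `ε` has law `μ`. -/
def observationLaw (A : Matrix (Fin N) (Fin n) 𝕜) (μ : Measure (Fin N → 𝕜)) (I : Finset (Fin N))
    (x : Fin n → 𝕜) : Measure (I → 𝕜) :=
  μ.map fun e i => (A *ᵥ x + e) i

/-- The estimator `∑ i ∈ I, λ_D i * b i` as a function of the observations indexed by `I`; it is
`⟨λ_D, b⟩` as soon as `λ_D` vanishes outside `I`. -/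
def estimator {A : Matrix (Fin N) (Fin n) 𝕜} {w : Fin n → 𝕜} (I : Finset (Fin N))
    (D : Divisor A w) (b : I → 𝕜) : 𝕜 :=
  ∑ i : I, divisorVector D i * b i

/-- The parameter of interest, `x ↦ ⟨w, x⟩ = ∑ j, w j * x j`. -/
def target (w : Fin n → 𝕜) : (Fin n → 𝕜) →ₗ[𝕜] 𝕜 :=
  dotProductBilin 𝕜 𝕜 w

end Estimator

/-! ### Statistics -/

section Statistics

variable {Θ Y Z : Type*} [MeasurableSpace Y] [MeasurableSpace Z]

/-- `T` is a complete statistic for the family `P`: a measurable function of `T` whose expectation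
vanishes under every member of the family is almost surely zero under every member. -/
def IsCompleteStatistic (𝕜 : Type*) [RCLike 𝕜] (P : Θ → Measure Y) (T : Y → Z) : Prop :=
  ∀ g : Z → 𝕜, Measurable g → (∀ θ, Integrable (fun y => g (T y)) (P θ)) →
    (∀ θ, ∫ y, g (T y) ∂(P θ) = 0) → ∀ θ, ∀ᵐ y ∂(P θ), g (T y) = 0

/-- `T` is a sufficient statistic for the family `P`: the conditional law of the observation given
`T` can be chosen the same for all members of the family. -/
def IsSufficientStatistic (P : Θ → Measure Y) (T : Y → Z) : Prop :=
  ∃ κ : Kernel Z Y, IsMarkovKernel κ ∧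
    ∀ θ, (P θ).map (fun y => (T y, y)) = ((P θ).map T) ⊗ₘ κ

/-- `T` is sufficient for the parameter of interest `ψ`, the rest of the parameter `x` being a
nuisance (Fraser's sufficiency, also called S-sufficiency): the law of `T` depends on `x` only
through `ψ x`, and there is a nuisance parameter `η`, such that `(ψ, η)` is a linear
reparametrization by a full product, for which the conditional law of the observation given `T`
depends on `x` only through `η x`; that is, for each fixed value of `η`, the statistic `T` is
sufficient in the ordinary sense. -/
def IsSufficientFor {𝕜 E : Type*} [RCLike 𝕜] [AddCommGroup E] [Module 𝕜 E]
    (P : E → Measure Y) (ψ : E →ₗ[𝕜] 𝕜) (T : Y → Z) : Prop :=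
  (∀ x x', ψ x = ψ x' → (P x).map T = (P x').map T) ∧
    ∃ η : E →ₗ[𝕜] LinearMap.ker ψ,
      Function.Bijective (fun x => (ψ x, η x)) ∧
        ∀ h, IsSufficientStatistic (fun x : {x : E // η x = h} => P x) T

variable {𝕜 : Type*} [RCLike 𝕜]

/-- `U` is an unbiased estimator of `g`. -/
def IsUnbiased (P : Θ → Measure Y) (g : Θ → 𝕜) (U : Y → 𝕜) : Prop :=
  Measurable U ∧ ∀ θ, Integrable U (P θ) ∧ ∫ y, U y ∂(P θ) = g θ

/-- The variance `E |U - E U|²`, possibly infinite. -/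
def eVar (U : Y → 𝕜) (ν : Measure Y) : ℝ≥0∞ :=
  ∫⁻ y, ‖U y - ∫ z, U z ∂ν‖ₑ ^ 2 ∂ν

/-- `U` is a (uniformly) minimum variance unbiased estimator of `g`. -/
def IsMVUE (P : Θ → Measure Y) (g : Θ → 𝕜) (U : Y → 𝕜) : Prop :=
  IsUnbiased P g U ∧ ∀ U', IsUnbiased P g U' → ∀ θ, eVar U (P θ) ≤ eVar U' (P θ)

end Statistics

end MatroidRegression

end

open MatroidRegression

/-! Put `l = λ_D`. Circuit vectors reduce everything to linear algebra: the vectors of divisors in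
`𝓛(I)` are exactly the `l` supported in `I` with `l A = w`
(`divisorVector_of_mem_particularSystemOn`, `exists_mem_particularSystemOn`). Hence `T = ⟨l, b⟩ =
⟨w, x⟩ + ⟨l, ε⟩`. The kernel `k(D, D)` is the squared `L²` norm of `⟨l, ε⟩`, so a minimizer is a
least-norm element of a finite-dimensional affine space and exists.

If `z` is a relation between the rows in `I`, all `l + a z` compete with `l`, because `𝓛(I) ⊆ 𝓛`.
Minimality therefore makes `⟨l, ε⟩` uncorrelated with `⟨z, ε⟩`. The vector of covariances of `⟨l,
ε⟩` with the `ε_i` is thus killed by all relations on `I`, so by duality it agrees on `I` with a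
column combination. Normalized by the variance of `⟨l, ε⟩`, this gives `v` with `⟨w, v⟩ = 1` such
that `r = ε - ⟨l, ε⟩ A v` is, on `I`, uncorrelated with `⟨l, ε⟩` (`exists_regression_direction`). By
Gaussianity, with circular symmetry in the complex case, it is independent of it.

With `η(x) = x - ⟨w, x⟩ v`, the observations are `b_I = A η(x) + T A v + r` on `I`, where `T` and
`r` are independent and the law of `r` is free of `x`. This is `IsLocationModel`, and the three
claims follow from it alone. Sufficiency is read off. Completeness is that of the translates of a
Gaussian law (`ae_eq_zero_of_integral_translates`): Cameron–Martin turns translations into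
exponential weights, and exponential moments determine a measure. Minimum variance is the
Lehmann–Scheffé argument at a fixed nuisance value. -/

namespace MatroidRegression

/-! ### Circuit vectors and representations of `w` -/

section CircuitVectors

variable {𝕜 : Type*} [RCLike 𝕜] {N n : ℕ} {A : Matrix (Fin N) (Fin n) 𝕜} {w : Fin n → 𝕜}

/-- A set of rows cannot be a particular and a general circuit at once. -/
theorem IsParticularCircuit.not_isGeneralCircuit {C : Finset (Fin N)}
    (h : IsParticularCircuit A w C) : ¬ IsGeneralCircuit A C := by
  rintro ⟨⟨z, hz, hz0, hzA⟩, -⟩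
  obtain ⟨⟨l, hl0, hlA⟩, h2⟩ := h
  obtain ⟨i, hi⟩ := Function.ne_iff.mp hz
  have hiC : i ∈ C := by
    by_contra hiC
    exact hi (hz0 i hiC)
  -- The multiple of the relation is chosen to cancel coordinate `i`: the result still represents
  -- `w` but vanishes inside `C`.
  refine h2 (l + (-(l i / z i)) • z) (fun j hj => by simp [hl0 j hj, hz0 j hj]) ?_ i hiC ?_
  · rw [Matrix.add_vecMul, Matrix.smul_vecMul, hlA, hzA, smul_zero, add_zero]
  · have : z i ≠ 0 := hi
    simp only [Pi.add_apply, Pi.smul_apply, smul_eq_mul]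
    field_simp
    ring

theorem circuitVector_apply_of_notMem (C : Circuit A w) {i : Fin N} (hi : i ∉ C.1) :
    circuitVector C i = 0 :=
  (Classical.choose_spec (exists_isCircuitVector C)).1 i hi

theorem circuitVector_vecMul_of_isParticularCircuit {C : Circuit A w}
    (hC : IsParticularCircuit A w C.1) : circuitVector C ᵥ* A = w := by
  rcases (Classical.choose_spec (exists_isCircuitVector C)).2 with h | h
  · exact h.2
  · exact absurd h.1 hC.not_isGeneralCircuit

theorem circuitVector_vecMul_of_isGeneralCircuit {C : Circuit A w}
    (hC : IsGeneralCircuit A C.1) : circuitVector C ᵥ* A = 0 := by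
  rcases (Classical.choose_spec (exists_isCircuitVector C)).2 with h | h
  · exact absurd hC h.1.not_isGeneralCircuit
  · exact h.2.1

theorem circuitVector_ne_zero_of_isGeneralCircuit {C : Circuit A w}
    (hC : IsGeneralCircuit A C.1) : circuitVector C ≠ 0 := by
  rcases (Classical.choose_spec (exists_isCircuitVector C)).2 with h | h
  · exact absurd hC h.1.not_isGeneralCircuit
  · intro h0
    have := h.2.2
    change ∑ i, ‖circuitVector C i‖ ^ 2 = 1 at this
    simp [h0] at this

@[simp]
theorem divisorVector_single (C : Circuit A w) (a : 𝕜) :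
    divisorVector (Finsupp.single C a) = a • circuitVector C :=
  Finsupp.linearCombination_single _ _ _

theorem divisorVector_of_mem_generalSystemOn {I : Finset (Fin N)} {D : Divisor A w}
    (hD : D ∈ generalSystemOn A w I) :
    (∀ i ∉ I, divisorVector D i = 0) ∧ divisorVector D ᵥ* A = 0 := by
  induction hD using Submodule.span_induction with
  | mem D h =>
    obtain ⟨C, hC, hCI, rfl⟩ := h
    refine ⟨fun i hi => ?_, ?_⟩
    · simp [circuitVector_apply_of_notMem C fun h => hi (hCI h)]
    · simp [circuitVector_vecMul_of_isGeneralCircuit hC]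
  | zero => simp
  | add D₁ D₂ _ _ h₁ h₂ =>
    refine ⟨fun i hi => ?_, ?_⟩
    · simp [h₁.1 i hi, h₂.1 i hi]
    · rw [map_add, Matrix.add_vecMul, h₁.2, h₂.2, add_zero]
  | smul a D _ h =>
    refine ⟨fun i hi => ?_, ?_⟩
    · simp [h.1 i hi]
    · rw [map_smul, Matrix.smul_vecMul, h.2, smul_zero]

/-- The vector of a divisor in `𝓛(I)` is supported in `I` and represents `w`. -/
theorem divisorVector_of_mem_particularSystemOn {I : Finset (Fin N)} {D : Divisor A w}
    (hD : D ∈ particularSystemOn A w I) :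
    (∀ i ∉ I, divisorVector D i = 0) ∧ divisorVector D ᵥ* A = w := by
  obtain ⟨C, hC, hCI, D', hD', h⟩ := hD
  obtain ⟨h0, hA⟩ := divisorVector_of_mem_generalSystemOn hD'
  rw [LinEquivalent, map_add, divisorVector_single, one_smul] at h
  refine ⟨fun i hi => ?_, ?_⟩
  · simp [h, h0 i hi, circuitVector_apply_of_notMem C fun h => hi (hCI h)]
  · rw [h, Matrix.add_vecMul, hA, circuitVector_vecMul_of_isParticularCircuit hC, add_zero]

/-- If `w` is a combination of the rows in `I`, then `I` contains a particular circuit. -/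
theorem exists_isParticularCircuit_subset {I : Finset (Fin N)} {l : Fin N → 𝕜}
    (h0 : ∀ i ∉ I, l i = 0) (hA : l ᵥ* A = w) : ∃ C ⊆ I, IsParticularCircuit A w C := by
  classical
  obtain ⟨C, hCI, hC⟩ := exists_minimal_le_of_wellFoundedLT
    (fun C : Finset (Fin N) => ∃ l : Fin N → 𝕜, (∀ i ∉ C, l i = 0) ∧ l ᵥ* A = w) I ⟨l, h0, hA⟩
  refine ⟨C, hCI, hC.prop, fun l hl hlA i hi hli => ?_⟩
  -- A solution vanishing at `i` lives on `C.erase i`, against minimality of `C`.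
  have hle := hC.le_of_le (y := C.erase i) ⟨l, fun j hj => ?_, hlA⟩ (Finset.erase_subset i C)
  · exact Finset.notMem_erase i C (hle hi)
  · by_cases hji : j = i
    · rwa [hji]
    · exact hl j fun hjC => hj (Finset.mem_erase.mpr ⟨hji, hjC⟩)

/-- The support of a nontrivial relation contains a general circuit. -/
theorem exists_isGeneralCircuit_subset {I : Finset (Fin N)} {z : Fin N → 𝕜} (hz : z ≠ 0)
    (h0 : ∀ i ∉ I, z i = 0) (hA : z ᵥ* A = 0) : ∃ C ⊆ I, IsGeneralCircuit A C := by
  classical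
  obtain ⟨C, hCI, hC⟩ := exists_minimal_le_of_wellFoundedLT
    (fun C : Finset (Fin N) => ∃ l : Fin N → 𝕜, l ≠ 0 ∧ (∀ i ∉ C, l i = 0) ∧ l ᵥ* A = 0) I
    ⟨z, hz, h0, hA⟩
  refine ⟨C, hCI, hC.prop, fun l hl0 hl hlA i hi hli => ?_⟩
  have hle := hC.le_of_le (y := C.erase i) ⟨l, hl0, fun j hj => ?_, hlA⟩ (Finset.erase_subset i C)
  · exact Finset.notMem_erase i C (hle hi)
  · by_cases hji : j = i
    · rwa [hji]
    · exact hl j fun hjC => hj (Finset.mem_erase.mpr ⟨hji, hjC⟩)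

/-- Every relation between the rows in `I` is represented by a general divisor on `I`. -/
theorem exists_mem_generalSystemOn (w : Fin n → 𝕜) (I : Finset (Fin N)) :
    ∀ z : Fin N → 𝕜, (∀ i ∉ I, z i = 0) → z ᵥ* A = 0 →
      ∃ D ∈ generalSystemOn A w I, divisorVector D = z := by
  classical
  induction I using Finset.strongInduction with
  | H I ih =>
    intro z h0 hA
    by_cases hz : z = 0
    · exact ⟨0, Submodule.zero_mem _, by simp [hz]⟩
    obtain ⟨C, hCI, hC⟩ := exists_isGeneralCircuit_subset hz h0 hA
    let C' : Circuit A w := ⟨C, Or.inr hC⟩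
    obtain ⟨i, hi⟩ := Function.ne_iff.mp
      (circuitVector_ne_zero_of_isGeneralCircuit (C := C') hC)
    have hi' : circuitVector C' i ≠ 0 := hi
    have hiC : i ∈ C := by
      by_contra hiC
      exact hi' (circuitVector_apply_of_notMem C' hiC)
    -- This multiple of the circuit vector clears coordinate `i` of `z`, so the induction continues
    -- on `I.erase i`.
    set a := z i / circuitVector C' i
    have hsupp : ∀ j ∉ I.erase i, (z - a • circuitVector C') j = 0 := by
      intro j hj
      by_cases hji : j = i
      · subst hji
        simp [a, div_mul_cancel₀ _ hi']
      · have hjI : j ∉ I := fun hjI => hj (Finset.mem_erase.mpr ⟨hji, hjI⟩)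
        simp [h0 j hjI, circuitVector_apply_of_notMem C' fun h => hjI (hCI h)]
    have hrel : (z - a • circuitVector C') ᵥ* A = 0 := by
      rw [Matrix.sub_vecMul, Matrix.smul_vecMul, hA,
        circuitVector_vecMul_of_isGeneralCircuit (C := C') hC, smul_zero, sub_zero]
    obtain ⟨D, hD, hDz⟩ := ih (I.erase i) (Finset.erase_ssubset (hCI hiC)) _ hsupp hrel
    refine ⟨D + a • Finsupp.single C' 1, Submodule.add_mem _ ?_ (Submodule.smul_mem _ _ ?_), ?_⟩
    · refine Submodule.span_mono ?_ hD
      rintro _ ⟨B, hB, hBI, rfl⟩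
      exact ⟨B, hB, hBI.trans (Finset.erase_subset i I), rfl⟩
    · exact Submodule.subset_span ⟨C', hC, hCI, rfl⟩
    · rw [map_add, map_smul, hDz, divisorVector_single, one_smul, sub_add_cancel]

/-- Every representation of `w` by the rows in `I` is the vector of a divisor in `𝓛(I)`. -/
theorem exists_mem_particularSystemOn {I : Finset (Fin N)} {l : Fin N → 𝕜}
    (h0 : ∀ i ∉ I, l i = 0) (hA : l ᵥ* A = w) :
    ∃ D ∈ particularSystemOn A w I, divisorVector D = l := by
  obtain ⟨C, hCI, hC⟩ := exists_isParticularCircuit_subset h0 hA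
  let C' : Circuit A w := ⟨C, Or.inl hC⟩
  obtain ⟨D, hD, hDz⟩ := exists_mem_generalSystemOn w I (A := A) (l - circuitVector C')
    (fun i hi => by simp [h0 i hi, circuitVector_apply_of_notMem C' fun h => hi (hCI h)])
    (by rw [Matrix.sub_vecMul, hA,
      circuitVector_vecMul_of_isParticularCircuit (C := C') hC, sub_self])
  exact ⟨Finsupp.single C' 1 + D, ⟨C', hC, hCI, D, hD, rfl⟩, by simp [hDz]⟩

end CircuitVectors

/-! ### Cameron–Martin and completeness of Gaussian translates -/

section GaussianTranslates

variable {E : Type*} [NormedAddCommGroup E] [NormedSpace ℝ E] [MeasurableSpace E] [BorelSpace E]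

theorem integrable_exp_dual (ν : Measure E) [IsGaussian ν] (l : StrongDual ℝ E) :
    Integrable (fun x => Real.exp (l x)) ν := by
  have h := integrable_exp_mul_gaussianReal (μ := ν[l]) (v := (Var[l; ν]).toNNReal) 1
  rw [← IsGaussian.map_eq_gaussianReal l, integrable_map_measure (by fun_prop) (by fun_prop)] at h
  simpa [Function.comp_def] using h

variable [SecondCountableTopology E] [CompleteSpace E]

/-- Finite measures with the same finite exponential moments are equal. -/
theorem measure_ext_of_integral_exp_eq {μ ν : Measure E} [IsFiniteMeasure μ] [IsFiniteMeasure ν]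
    (hμ : ∀ l : StrongDual ℝ E, Integrable (fun x => Real.exp (l x)) μ)
    (h : ∀ l : StrongDual ℝ E, ∫ x, Real.exp (l x) ∂μ = ∫ x, Real.exp (l x) ∂ν) : μ = ν := by
  have h0 : μ = 0 ↔ ν = 0 := by
    have h1 : μ.real Set.univ = ν.real Set.univ := by simpa using h 0
    rw [← Measure.measure_univ_eq_zero, ← Measure.measure_univ_eq_zero,
      ← measureReal_eq_zero_iff, ← measureReal_eq_zero_iff, h1]
  refine Measure.ext_of_charFunDual (funext fun l => ?_)
  have hmgf : mgf l μ = mgf l ν := by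
    funext t
    simpa [mgf] using h (t • l)
  have hset : integrableExpSet l μ = Set.univ := by
    ext t
    simpa [integrableExpSet] using hμ (t • l)
  -- The moment generating functions are finite on all of `ℝ`, so they extend analytically to `ℂ`;
  -- the value at `Complex.I` is the characteristic function.
  have := eqOn_complexMGF_of_mgf' hmgf h0 (x := Complex.I) (by simp [hset])
  simpa [charFunDual_apply, complexMGF, mul_comm] using this

variable {ν : Measure E} [IsGaussian ν]

theorem integral_exp_dual (hν : ∫ x, x ∂ν = 0) (l : StrongDual ℝ E) :
    ∫ x, Real.exp (l x) ∂ν = Real.exp (Var[l; ν] / 2) := by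
  have h := mgf_gaussianReal (IsGaussian.map_eq_gaussianReal (μ := ν) l) 1
  have h0 : ν[l] = 0 := by rw [IsGaussian.integral_dual, hν, map_zero]
  simpa [mgf, h0, Real.coe_toNNReal _ (variance_nonneg _ _)] using h

/-- **Cameron–Martin**: translating a centered Gaussian measure by `∫ l x • x` amounts to an
exponential change of density. -/
theorem map_add_eq_withDensity (hν : ∫ x, x ∂ν = 0) (l : StrongDual ℝ E) :
    ν.map (fun x => (∫ y, l y • y ∂ν) + x) =
      ν.withDensity fun x => ENNReal.ofReal (Real.exp (l x - Var[l; ν] / 2)) := by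
  set m := ∫ y, l y • y ∂ν with hm
  have hinteg : Integrable (fun x => Real.exp (l x - Var[l; ν] / 2)) ν := by
    simpa [Real.exp_sub] using (integrable_exp_dual ν l).div_const _
  have : IsFiniteMeasure
      (ν.withDensity fun x => ENNReal.ofReal (Real.exp (l x - Var[l; ν] / 2))) :=
    isFiniteMeasure_withDensity_ofReal hinteg.2
  have : IsFiniteMeasure (ν.map (fun x => m + x)) := inferInstance
  -- `m` represents covariance with `l`, so the cross term in the variance of `k + l` is exactly the
  -- shift `k m`.
  have hcov (k : StrongDual ℝ E) : cov[k, l; ν] = k m := by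
    rw [covariance_eq_sub (IsGaussian.memLp_dual ν k 2 (by simp))
      (IsGaussian.memLp_dual ν l 2 (by simp)), IsGaussian.integral_dual, hν, map_zero, zero_mul,
      sub_zero, hm, ← k.integral_comp_comm]
    · simp [mul_comm]
    · rw [← memLp_one_iff_integrable]
      exact MemLp.smul (q := 2) (p := 2) (IsGaussian.memLp_two_id (μ := ν))
        (IsGaussian.memLp_dual ν l 2 (by simp))
  refine measure_ext_of_integral_exp_eq (fun k => ?_) fun k => ?_
  · rw [integrable_map_measure (by fun_prop) (by fun_prop)]
    simpa [Function.comp_def, Real.exp_add] using (integrable_exp_dual ν k).const_mul _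
  · rw [integral_map (by fun_prop) (by fun_prop),
      integral_withDensity_eq_integral_toReal_smul (by fun_prop) (by simp)]
    have h1 : ∀ x, Real.exp (k (m + x)) = Real.exp (k m) * Real.exp (k x) := by
      simp [Real.exp_add]
    have h2 : ∀ x, (ENNReal.ofReal (Real.exp (l x - Var[l; ν] / 2))).toReal • Real.exp (k x) =
        Real.exp (-(Var[l; ν] / 2)) * Real.exp ((k + l) x) := by
      intro x
      rw [ENNReal.toReal_ofReal (Real.exp_pos _).le, smul_eq_mul, ← Real.exp_add, ← Real.exp_add]
      congr 1
      simp only [add_apply]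
      ring
    simp_rw [h1, h2]
    rw [integral_const_mul, integral_const_mul, integral_exp_dual hν, integral_exp_dual hν,
      ← Real.exp_add, ← Real.exp_add]
    congr 1
    have hv : Var[(k + l : StrongDual ℝ E); ν] = Var[k; ν] + 2 * cov[k, l; ν] + Var[l; ν] :=
      variance_add (IsGaussian.memLp_dual ν k 2 (by simp)) (IsGaussian.memLp_dual ν l 2 (by simp))
    rw [hv, hcov]
    ring

/-- Completeness of the translates of a centered Gaussian measure, possibly degenerate: real
functions. -/
theorem ae_eq_zero_of_integral_translates_real (hν : ∫ x, x ∂ν = 0) {g : E → ℝ}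
    (hg : Measurable g) (hinteg : ∀ m, Integrable g (ν.map fun x => m + x))
    (h0 : ∀ m, ∫ x, g x ∂(ν.map fun x => m + x) = 0) : g =ᵐ[ν] 0 := by
  have hg0 : Integrable g ν := by simpa using hinteg 0
  -- Only translations by Cameron–Martin vectors are used here; they already supply every
  -- exponential weight, even for degenerate `ν`.
  have hgl (l : StrongDual ℝ E) : Integrable (fun x => Real.exp (l x) * g x) ν := by
    have := hinteg (∫ y, l y • y ∂ν)
    rw [map_add_eq_withDensity hν, integrable_withDensity_iff_integrable_smul' (by fun_prop)
      (by simp)] at this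
    refine (this.const_mul (Real.exp (Var[l; ν] / 2))).congr (ae_of_all _ fun x => ?_)
    simp only [ENNReal.toReal_ofReal (Real.exp_pos _).le, smul_eq_mul, ← mul_assoc, ← Real.exp_add]
    simp
  have hgz (l : StrongDual ℝ E) : ∫ x, Real.exp (l x) * g x ∂ν = 0 := by
    have := h0 (∫ y, l y • y ∂ν)
    rw [map_add_eq_withDensity hν, integral_withDensity_eq_integral_toReal_smul (by fun_prop)
      (by simp)] at this
    simp only [ENNReal.toReal_ofReal (Real.exp_pos _).le, smul_eq_mul] at this
    simp only [sub_eq_add_neg, Real.exp_add, mul_right_comm _ _ (g _)] at this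
    rw [integral_mul_const] at this
    exact (mul_eq_zero.mp this).resolve_right (Real.exp_pos _).ne'
  have hfin {f : E → ℝ} (hf : Integrable f ν) :
      IsFiniteMeasure (ν.withDensity fun x => ENNReal.ofReal (f x)) :=
    isFiniteMeasure_withDensity_ofReal hf.2
  have := hfin hg0
  have := hfin hg0.neg
  have hpos (l : StrongDual ℝ E) :
      Integrable (fun x => max (g x) 0 * Real.exp (l x)) ν := by
    refine (hgl l).pos_part.congr (ae_of_all _ fun x => ?_)
    simp only
    rw [mul_comm, max_mul_of_nonneg _ _ (Real.exp_pos _).le, zero_mul, mul_comm]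
  have hneg (l : StrongDual ℝ E) :
      Integrable (fun x => max (-g x) 0 * Real.exp (l x)) ν := by
    refine (hgl l).neg_part.congr (ae_of_all _ fun x => ?_)
    simp only
    rw [← mul_neg, mul_comm, max_mul_of_nonneg _ _ (Real.exp_pos _).le, zero_mul, mul_comm]
  -- The vanishing integrals say that the positive and negative parts of `g` have equal exponential
  -- moments, so they define the same measure.
  have heq : ν.withDensity (fun x => ENNReal.ofReal (g x)) =
      ν.withDensity fun x => ENNReal.ofReal ((-g) x) := by
    refine measure_ext_of_integral_exp_eq (fun l => ?_) fun l => ?_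
    · rw [integrable_withDensity_iff_integrable_smul' (by fun_prop) (by simp)]
      simpa [ENNReal.toReal_ofReal'] using hpos l
    · rw [integral_withDensity_eq_integral_toReal_smul (by fun_prop) (by simp),
        integral_withDensity_eq_integral_toReal_smul (by fun_prop) (by simp)]
      simp only [ENNReal.toReal_ofReal', smul_eq_mul, Pi.neg_apply]
      rw [← sub_eq_zero, ← integral_sub (hpos l) (hneg l)]
      refine (integral_congr_ae (ae_of_all _ fun x => ?_)).trans (hgz l)
      rw [← sub_mul, mul_comm, max_zero_sub_max_neg_zero_eq_self]
  rw [withDensity_eq_iff (by fun_prop) (by fun_prop)] at heq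
  · filter_upwards [heq] with x hx
    simp only [Pi.neg_apply] at hx
    rcases lt_trichotomy (g x) 0 with h | h | h
    · rw [ENNReal.ofReal_of_nonpos h.le, eq_comm, ENNReal.ofReal_eq_zero] at hx
      linarith
    · simpa using h
    · rw [ENNReal.ofReal_of_nonpos (by linarith : -g x ≤ 0), ENNReal.ofReal_eq_zero] at hx
      linarith
  · exact ((lintegral_ofReal_le_lintegral_enorm g).trans_lt hg0.2).ne

/-- Completeness of the translates of a centered Gaussian measure, possibly degenerate. -/
theorem ae_eq_zero_of_integral_translates {𝕜 : Type*} [RCLike 𝕜] (hν : ∫ x, x ∂ν = 0) {g : E → 𝕜}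
    (hg : Measurable g) (hinteg : ∀ m, Integrable g (ν.map fun x => m + x))
    (h0 : ∀ m, ∫ x, g x ∂(ν.map fun x => m + x) = 0) (m : E) :
    ∀ᵐ x ∂(ν.map fun x => m + x), g x = 0 := by
  -- A degenerate `ν` may be singular to its translates, so the null set is found for each `m`
  -- separately, by applying the centered case to `g (m + ·)`.
  have hcomp (k : E) : (ν.map fun x => k + x).map (fun x => m + x) =
      ν.map fun x => (m + k) + x := by
    rw [Measure.map_map (by fun_prop) (by fun_prop)]
    congr 1
    funext x
    simp [add_assoc]
  have hinteg' (k : E) : Integrable (fun x => g (m + x)) (ν.map fun x => k + x) := by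
    have := hinteg (m + k)
    rw [← hcomp, integrable_map_measure (by fun_prop) (by fun_prop)] at this
    exact this
  have h0' (k : E) : ∫ x, g (m + x) ∂(ν.map fun x => k + x) = 0 := by
    have := h0 (m + k)
    rwa [← hcomp, integral_map (by fun_prop) (by fun_prop)] at this
  have hre : (fun x => RCLike.re (g (m + x))) =ᵐ[ν] 0 :=
    ae_eq_zero_of_integral_translates_real hν (by fun_prop) (fun k => (hinteg' k).re) fun k => by
      rw [integral_re (hinteg' k), h0', map_zero]
  have him : (fun x => RCLike.im (g (m + x))) =ᵐ[ν] 0 :=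
    ae_eq_zero_of_integral_translates_real hν (by fun_prop) (fun k => (hinteg' k).im) fun k => by
      rw [integral_im (hinteg' k), h0', map_zero]
  rw [ae_map_iff (by fun_prop) (measurableSet_eq_fun hg measurable_const)]
  filter_upwards [hre, him] with x h1 h2
  exact RCLike.ext (by simpa using h1) (by simpa using h2)

end GaussianTranslates

/-! ### Least-norm elements of affine subspaces -/

section LeastNorm

variable {𝕜 V H : Type*} [RCLike 𝕜] [AddCommGroup V] [Module 𝕜 V] [NormedAddCommGroup H]
  [InnerProductSpace 𝕜 H]

/-- The norm of a linear map with finite-dimensional range attains its minimum on every nonempty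
affine subspace. -/
theorem exists_norm_le_of_mem_affineSubspace (F : V →ₗ[𝕜] H)
    [FiniteDimensional 𝕜 (LinearMap.range F)] {L : AffineSubspace 𝕜 V} (hL : (L : Set V).Nonempty) :
    ∃ D ∈ L, ∀ D' ∈ L, ‖F D‖ ≤ ‖F D'‖ := by
  obtain ⟨D₀, hD₀⟩ := hL
  let K : Submodule 𝕜 H := L.direction.map F
  have : FiniteDimensional 𝕜 K :=
    Submodule.finiteDimensional_of_le (S₂ := LinearMap.range F) (LinearMap.map_le_range)
  obtain ⟨v, hv, hmin⟩ := K.exists_norm_eq_iInf_of_complete_subspace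
    (Submodule.complete_of_finiteDimensional K) (F D₀)
  obtain ⟨d, hd, rfl⟩ := hv
  have hmem (D' : V) (hD' : D' ∈ L) : D₀ - D' ∈ L.direction := by
    simpa using AffineSubspace.vsub_mem_direction hD₀ hD'
  refine ⟨D₀ - d, ?_, fun D' hD' => ?_⟩
  · have := AffineSubspace.vadd_mem_of_mem_direction (Submodule.neg_mem _ hd) hD₀
    simpa [sub_eq_add_neg, add_comm] using this
  · rw [map_sub, hmin]
    refine (ciInf_le ⟨0, ?_⟩ (⟨F (D₀ - D'), D₀ - D', hmem D' hD', rfl⟩ : (K : Set H))).trans ?_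
    · rintro _ ⟨x, rfl⟩
      exact norm_nonneg _
    · simp

/-- A vector that is shortest on its line in direction `y` is orthogonal to `y`. -/
theorem inner_eq_zero_of_norm_le_add_smul {x y : H} (h : ∀ a : 𝕜, ‖x‖ ≤ ‖x + a • y‖) :
    inner 𝕜 x y = 0 := by
  have h0 : ‖x - 0‖ = ⨅ z : (Submodule.span 𝕜 {y} : Set H), ‖x - z‖ := by
    refine le_antisymm (le_ciInf ?_) (ciInf_le ⟨0, ?_⟩ (⟨0, Submodule.zero_mem _⟩ :
      (Submodule.span 𝕜 {y} : Set H)))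
    · rintro ⟨z, hz⟩
      obtain ⟨a, rfl⟩ := Submodule.mem_span_singleton.mp hz
      simpa [sub_eq_add_neg] using h (-a)
    · rintro _ ⟨z, rfl⟩
      exact norm_nonneg _
  simpa using (Submodule.norm_eq_iInf_iff_inner_eq_zero _ (Submodule.zero_mem _)).mp h0 y
    (Submodule.mem_span_singleton_self y)

end LeastNorm

/-! ### The circuit kernel as an `L²` Gram form -/

section NoiseMoments

variable {𝕜 : Type*} [RCLike 𝕜] {N n : ℕ} {μ : Measure (Fin N → 𝕜)}

theorem memLp_two_eval [IsGaussian μ] (i : Fin N) : MemLp (fun e => e i) 2 μ :=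
  HasGaussianLaw.memLp_two ((IsGaussian.hasGaussianLaw_id (μ := μ)).map
    (ContinuousLinearMap.proj (R := ℝ) (φ := fun _ : Fin N => 𝕜) i))

theorem memLp_two_dotProduct [IsGaussian μ] (l : Fin N → 𝕜) : MemLp (fun e => l ⬝ᵥ e) 2 μ :=
  memLp_finsetSum _ fun i _ => (memLp_two_eval i).const_mul (l i)

/-- The noise evaluated at a vector, as an element of `L²`. -/
noncomputable def noiseEval (μ : Measure (Fin N → 𝕜)) [IsGaussian μ] :
    (Fin N → 𝕜) →ₗ[𝕜] Lp 𝕜 2 μ where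
  toFun u := (memLp_two_dotProduct u).toLp
  map_add' u v := by
    rw [← MemLp.toLp_add]
    exact MemLp.toLp_congr _ _ (ae_of_all _ fun e => add_dotProduct u v e)
  map_smul' a u := by
    rw [RingHom.id_apply, ← MemLp.toLp_const_smul]
    exact MemLp.toLp_congr _ _ (ae_of_all _ fun e => smul_dotProduct a u e)

theorem coeFn_noiseEval [IsGaussian μ] (u : Fin N → 𝕜) :
    noiseEval μ u =ᵐ[μ] fun e => u ⬝ᵥ e :=
  (memLp_two_dotProduct u).coeFn_toLp

theorem inner_noiseEval_eq_integral [IsGaussian μ] (u v : Fin N → 𝕜) :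
    inner 𝕜 (noiseEval μ u) (noiseEval μ v) = ∫ e, star (u ⬝ᵥ e) * (v ⬝ᵥ e) ∂μ := by
  rw [L2.inner_def]
  refine integral_congr_ae ?_
  filter_upwards [coeFn_noiseEval (μ := μ) u, coeFn_noiseEval (μ := μ) v] with e hu hv
  rw [hu, hv, RCLike.inner_apply, mul_comm]
  rfl

/-- By sesquilinearity only basis vectors matter, where this is the definition of `noiseCov`. It
turns kernel minimization into a Hilbert space problem. -/
theorem inner_noiseEval [IsGaussian μ] (u v : Fin N → 𝕜) :
    inner 𝕜 (noiseEval μ u) (noiseEval μ v) = star u ⬝ᵥ (noiseCov μ *ᵥ v) := by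
  classical
  have h (i j : Fin N) : inner 𝕜 (noiseEval μ fun k => if i = k then 1 else 0)
      (noiseEval μ fun k => if j = k then 1 else 0) = noiseCov μ i j := by
    simp [inner_noiseEval_eq_integral, noiseCov, dotProduct]
  rw [LinearMap.pi_apply_eq_sum_univ (noiseEval μ) u,
    LinearMap.pi_apply_eq_sum_univ (noiseEval μ) v]
  simp only [sum_inner, inner_sum, inner_smul_left, inner_smul_right, h]
  simp only [dotProduct, Matrix.mulVec, Finset.mul_sum, Pi.star_apply, starRingEnd_apply]
  rw [Finset.sum_comm]
  refine Finset.sum_congr rfl fun i _ => Finset.sum_congr rfl fun j _ => ?_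
  ring

theorem re_circuitKernel_self [IsGaussian μ] {A : Matrix (Fin N) (Fin n) 𝕜} {w : Fin n → 𝕜}
    (D : Divisor A w) :
    RCLike.re (circuitKernel (noiseCov μ) D D) = ‖noiseEval μ (divisorVector D)‖ ^ 2 := by
  rw [circuitKernel, ← inner_noiseEval, inner_self_eq_norm_sq]

/-- The circuit kernel attains its minimum on every particular system. -/
theorem exists_isKernelMinimizer [IsGaussian μ] {A : Matrix (Fin N) (Fin n) 𝕜} {w : Fin n → 𝕜}
    {L : AffineSubspace 𝕜 (Divisor A w)} (hL : (L : Set (Divisor A w)).Nonempty) :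
    ∃ D, IsKernelMinimizer (noiseCov μ) L D := by
  have : FiniteDimensional 𝕜 (LinearMap.range (noiseEval μ ∘ₗ divisorVector (A := A) (w := w))) :=
    Submodule.finiteDimensional_of_le (LinearMap.range_comp_le_range _ (noiseEval μ))
  obtain ⟨D, hD, hmin⟩ := exists_norm_le_of_mem_affineSubspace
    (noiseEval μ ∘ₗ divisorVector (A := A) (w := w)) hL
  refine ⟨D, hD, fun D' hD' => ?_⟩
  rw [re_circuitKernel_self, re_circuitKernel_self]
  exact pow_le_pow_left₀ (norm_nonneg _) (hmin D' hD') 2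

/-- The estimator of a minimizer is uncorrelated with every relation between the rows in the
support. -/
theorem IsKernelMinimizer.integral_star_mul_eq_zero [IsGaussian μ] {A : Matrix (Fin N) (Fin n) 𝕜}
    {w : Fin n → 𝕜} {L : AffineSubspace 𝕜 (Divisor A w)} {D : Divisor A w}
    (hD : IsKernelMinimizer (noiseCov μ) L D) (hL : IsParticularSystem L)
    {I : Finset (Fin N)} (hI : particularSystemOn A w I ⊆ (L : Set (Divisor A w)))
    (hDI : ∀ i ∉ I, divisorVector D i = 0) {z : Fin N → 𝕜} (hz : ∀ i ∉ I, z i = 0)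
    (hzA : z ᵥ* A = 0) : ∫ e, star (divisorVector D ⬝ᵥ e) * (z ⬝ᵥ e) ∂μ = 0 := by
  rw [← inner_noiseEval_eq_integral]
  refine inner_eq_zero_of_norm_le_add_smul fun a => ?_
  have hDA : divisorVector D ᵥ* A = w :=
    (divisorVector_of_mem_particularSystemOn (hL.subset hD.1)).2
  -- The perturbed vector still represents `w` on `I`, so it comes from a competitor in `𝓛(I)`.
  obtain ⟨D', hD', hv⟩ := exists_mem_particularSystemOn (I := I) (A := A) (w := w)
    (l := divisorVector D + a • z) (fun i hi => by simp [hDI i hi, hz i hi])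
    (by rw [Matrix.add_vecMul, Matrix.smul_vecMul, hDA, hzA, smul_zero, add_zero])
  have := hD.2 D' (hI hD')
  rw [re_circuitKernel_self, re_circuitKernel_self, hv, map_add, map_smul] at this
  exact (pow_le_pow_iff_left₀ (norm_nonneg _) (norm_nonneg _) two_ne_zero).mp this

end NoiseMoments

/-! ### From vanishing covariances to independence -/

section Independence

variable {𝕜 : Type*} [RCLike 𝕜]

theorem star_eq_self_of_I_eq_zero (h : (RCLike.I : 𝕜) = 0) (z : 𝕜) : star z = z := by
  have him : RCLike.im z = 0 := by
    rw [← RCLike.I_im z, h, map_zero, mul_zero]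
  exact RCLike.conj_eq_iff_im.mpr him

theorem exists_dual_eq_re_mul (l : StrongDual ℝ 𝕜) : ∃ a : 𝕜, ∀ z, l z = RCLike.re (a * z) := by
  -- The formula also serves `𝕜 = ℝ`, where `RCLike.I = 0` and only the first term remains.
  refine ⟨(l 1 : 𝕜) - (l RCLike.I : 𝕜) * RCLike.I, fun z => ?_⟩
  have h : l z = RCLike.re z * l 1 + RCLike.im z * l RCLike.I := by
    have hz : z = (RCLike.re z : ℝ) • (1 : 𝕜) + (RCLike.im z : ℝ) • (RCLike.I : 𝕜) := by
      simp [RCLike.real_smul_eq_coe_mul]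
    conv_lhs => rw [hz]
    simp
  have hI : RCLike.im (RCLike.I : 𝕜) * RCLike.im z = RCLike.im z := by
    rw [mul_comm, RCLike.I_im]
  rw [h, sub_mul, map_sub, mul_assoc, RCLike.re_ofReal_mul, RCLike.re_ofReal_mul, RCLike.mul_re,
    RCLike.I_re, zero_mul, hI]
  ring

variable {Ω : Type*} [MeasurableSpace Ω] {P : Measure Ω}

/-- Scalar variables with vanishing covariance and pseudo-covariance are uncorrelated as real
vectors. -/
theorem integral_dual_mul_dual_eq_zero {f g : Ω → 𝕜} (hf : MemLp f 2 P) (hg : MemLp g 2 P)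
    (h1 : ∫ ω, f ω * g ω ∂P = 0) (h2 : ∫ ω, star (f ω) * g ω ∂P = 0) (k l : StrongDual ℝ 𝕜) :
    ∫ ω, k (f ω) * l (g ω) ∂P = 0 := by
  obtain ⟨a, ha⟩ := exists_dual_eq_re_mul k
  obtain ⟨b, hb⟩ := exists_dual_eq_re_mul l
  have hi1 : Integrable (fun ω => f ω * g ω) P := hf.integrable_mul hg
  have hi2 : Integrable (fun ω => star (f ω) * g ω) P := hf.star.integrable_mul hg
  -- Polarization: a product of real parts involves both `f g` and `star f * g`, hence the need for
  -- the pseudo-covariance.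
  have key (ω : Ω) : k (f ω) * l (g ω) =
      2⁻¹ * RCLike.re (a * b * (f ω * g ω) + star a * b * (star (f ω) * g ω)) := by
    have hre (u v : 𝕜) : RCLike.re u * RCLike.re v = 2⁻¹ * RCLike.re (u * v + star u * v) := by
      simp only [map_add, RCLike.mul_re, RCLike.star_def, RCLike.conj_re, RCLike.conj_im]
      ring
    rw [ha, hb, hre, star_mul']
    congr 2
    ring
  have hi : Integrable (fun ω => a * b * (f ω * g ω) + star a * b * (star (f ω) * g ω)) P :=
    (hi1.const_mul _).add (hi2.const_mul _)
  simp_rw [key]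
  rw [integral_const_mul, integral_re hi, integral_add (hi1.const_mul _) (hi2.const_mul _),
    integral_const_mul, integral_const_mul,
    h1, h2]
  simp

variable {ι : Type*} [Fintype ι]

/-- A scalar and a vector that are jointly Gaussian, with vanishing covariances and
pseudo-covariances, are independent. -/
theorem indepFun_of_integral_mul_eq_zero {f : Ω → 𝕜} {g : Ω → ι → 𝕜}
    (hfg : HasGaussianLaw (fun ω => (f ω, g ω)) P) (hf : ∫ ω, f ω ∂P = 0)
    (h1 : ∀ i, ∫ ω, f ω * g ω i ∂P = 0) (h2 : ∀ i, ∫ ω, star (f ω) * g ω i ∂P = 0) :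
    IndepFun f g P := by
  classical
  have := hfg.isProbabilityMeasure
  have hf2 : MemLp f 2 P := hfg.fst.memLp_two
  have hg2 : MemLp g 2 P := hfg.snd.memLp_two
  have hgi (i : ι) : MemLp (fun ω => g ω i) 2 P := memLp_pi_iff.mp hg2 i
  refine hfg.indepFun_of_covariance_strongDual fun k l => ?_
  rw [covariance_eq_sub (k.comp_memLp' hf2) (l.comp_memLp' hg2)]
  have hk : ∫ ω, (k ∘ f) ω ∂P = 0 := by
    simp only [Function.comp_apply]
    rw [k.integral_comp_comm (hf2.integrable one_le_two), hf, map_zero]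
  rw [hk, zero_mul, sub_zero]
  let m (i : ι) : StrongDual ℝ 𝕜 := l ∘L ContinuousLinearMap.single ℝ (fun _ : ι => 𝕜) i
  have hl (r : ι → 𝕜) : l r = ∑ i, m i (r i) := by
    conv_lhs => rw [← Finset.univ_sum_single r, map_sum]
    rfl
  simp only [Pi.mul_apply, Function.comp_apply, hl, Finset.mul_sum]
  rw [integral_finsetSum]
  · exact Finset.sum_eq_zero fun i _ =>
      integral_dual_mul_dual_eq_zero hf2 (hgi i) (h1 i) (h2 i) k (m i)
  · exact fun i _ => (k.comp_memLp' hf2).integrable_mul ((m i).comp_memLp' (hgi i))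

end Independence

/-! ### The residual after regression on the estimator -/

section Residual

variable {𝕜 : Type*} [RCLike 𝕜] {N n : ℕ} {μ : Measure (Fin N → 𝕜)}

theorem IsGaussianNoise.integral_dotProduct (hμ : IsGaussianNoise μ) (l : Fin N → 𝕜) :
    ∫ e, l ⬝ᵥ e ∂μ = 0 := by
  have := hμ.gaussian
  simp only [dotProduct]
  rw [integral_finsetSum _ fun i _ =>
    ((memLp_two_eval (μ := μ) i).integrable one_le_two).const_mul (l i)]
  exact Finset.sum_eq_zero fun i _ => by rw [integral_const_mul, hμ.centered i, mul_zero]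

theorem IsGaussianNoise.integral_dotProduct_mul_dotProduct (hμ : IsGaussianNoise μ)
    (hI : (RCLike.I : 𝕜) ≠ 0) (u v : Fin N → 𝕜) :
    ∫ e, (u ⬝ᵥ e) * (v ⬝ᵥ e) ∂μ = 0 := by
  have := hμ.gaussian
  have hinteg (i j : Fin N) : Integrable (fun e : Fin N → 𝕜 => u i * e i * (v j * e j)) μ :=
    ((memLp_two_eval (μ := μ) i).const_mul (u i)).integrable_mul
      ((memLp_two_eval (μ := μ) j).const_mul (v j))
  simp only [dotProduct, Finset.sum_mul_sum]
  rw [integral_finsetSum _ fun i _ => integrable_finsetSum _ fun j _ => hinteg i j]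
  refine Finset.sum_eq_zero fun i _ => ?_
  rw [integral_finsetSum _ fun j _ => hinteg i j]
  refine Finset.sum_eq_zero fun j _ => ?_
  simp_rw [mul_mul_mul_comm (u i)]
  rw [integral_const_mul, hμ.circular hI, mul_zero]

/-- The residual of the noise in the rows in `I` after removal of the multiple `c` of its evaluation
at `l`. -/
def residual (I : Finset (Fin N)) (l : Fin N → 𝕜) (c : Fin N → 𝕜) (e : Fin N → 𝕜) : I → 𝕜 :=
  fun i => e i - c i * (l ⬝ᵥ e)

theorem continuous_dotProduct_left (l : Fin N → 𝕜) : Continuous fun e : Fin N → 𝕜 => l ⬝ᵥ e :=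
  continuous_const.dotProduct continuous_id

theorem continuous_residual (I : Finset (Fin N)) (l c : Fin N → 𝕜) :
    Continuous (residual I l c) :=
  continuous_pi fun _ =>
    (continuous_apply _).sub (continuous_const.mul (continuous_dotProduct_left l))

/-- The residual is independent of the evaluation at `l` as soon as they are uncorrelated. -/
theorem IsGaussianNoise.indepFun_residual (hμ : IsGaussianNoise μ) {I : Finset (Fin N)}
    {l c : Fin N → 𝕜} (h : ∀ i ∈ I, ∫ e, star (l ⬝ᵥ e) * (e i - c i * (l ⬝ᵥ e)) ∂μ = 0) :
    IndepFun (fun e => l ⬝ᵥ e) (residual I l c) μ := by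
  classical
  have := hμ.gaussian
  let F : (Fin N → 𝕜) →L[ℝ] 𝕜 × (I → 𝕜) :=
    { toFun := fun e => (l ⬝ᵥ e, residual I l c e)
      map_add' := fun e e' => by
        ext <;> simp [residual, dotProduct_add]
        ring
      map_smul' := fun a e => by
        ext <;> simp [residual, dotProduct_smul, smul_sub]
      cont := (continuous_dotProduct_left l).prodMk (continuous_residual I l c) }
  have hF : HasGaussianLaw (fun e => (l ⬝ᵥ e, residual I l c e)) μ :=
    (IsGaussian.hasGaussianLaw_id (μ := μ)).map F
  refine indepFun_of_integral_mul_eq_zero hF (hμ.integral_dotProduct l) (fun i => ?_)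
    fun i => h i i.2
  -- In the real case the pseudo-covariance is the covariance; in the complex case it vanishes by
  -- circular symmetry.
  by_cases hI : (RCLike.I : 𝕜) = 0
  · simpa only [star_eq_self_of_I_eq_zero hI, residual] using h i i.2
  · have hr (e : Fin N → 𝕜) : residual I l c e i = (Pi.single (i : Fin N) 1 - c i • l) ⬝ᵥ e := by
      simp [residual, sub_dotProduct]
    simp_rw [hr]
    exact hμ.integral_dotProduct_mul_dotProduct hI _ _

end Residual

/-! ### Duality between row relations and the column space -/

section Direction

variable {𝕜 : Type*} [RCLike 𝕜] {N n : ℕ}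

/-- A vector killed by all relations between the rows in `I` is, on `I`, in the column space. -/
theorem exists_mulVec_eq_of_forall_dotProduct_eq_zero (A : Matrix (Fin N) (Fin n) 𝕜)
    (I : Finset (Fin N)) (q : Fin N → 𝕜)
    (h : ∀ z : Fin N → 𝕜, (∀ i ∉ I, z i = 0) → z ᵥ* A = 0 → z ⬝ᵥ q = 0) :
    ∃ v, ∀ i ∈ I, (A *ᵥ v) i = q i := by
  classical
  let res : (Fin N → 𝕜) →ₗ[𝕜] (I → 𝕜) := LinearMap.funLeft 𝕜 𝕜 (Subtype.val : I → Fin N)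
  by_cases hq : res q ∈ LinearMap.range (res ∘ₗ A.mulVecLin)
  · obtain ⟨v, hv⟩ := hq
    exact ⟨v, fun i hi => congrFun hv ⟨i, hi⟩⟩
  -- Otherwise a functional separates `q` from the column space on `I`; its coefficients `z` form a
  -- row relation with `z ⬝ᵥ q ≠ 0`.
  obtain ⟨f, hf, hle⟩ := Submodule.exists_le_ker_of_notMem hq
  let z : Fin N → 𝕜 := fun i => f (res (Pi.single i 1))
  have hz (u : Fin N → 𝕜) : z ⬝ᵥ u = f (res u) := by
    have := LinearMap.pi_apply_eq_sum_univ (f ∘ₗ res) u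
    simp only [LinearMap.comp_apply] at this
    rw [this, dotProduct]
    refine Finset.sum_congr rfl fun i _ => ?_
    rw [smul_eq_mul, mul_comm]
    have hs : (Pi.single i 1 : Fin N → 𝕜) = fun j => if i = j then 1 else 0 := by
      funext j
      simp [Pi.single_apply, eq_comm]
    rw [← hs]
  refine absurd ?_ hf
  rw [← hz]
  refine h z (fun i hi => ?_) ?_
  · have : res (Pi.single i 1) = 0 := by
      funext j
      have : (j : Fin N) ≠ i := fun h => hi (h ▸ j.2)
      simp [res, LinearMap.funLeft_apply, this]
    simp [z, this]
  · refine dotProduct_eq_zero_iff.mp fun x => ?_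
    rw [← Matrix.dotProduct_mulVec, hz]
    exact hle ⟨x, rfl⟩

end Direction

/-! ### Variance decomposition in `L²` -/

section Pythagoras

variable {𝕜 : Type*} [RCLike 𝕜] {Ω : Type*} [MeasurableSpace Ω] {P : Measure Ω}

theorem lintegral_enorm_sq_eq_ofReal {f : Ω → 𝕜} (hf : MemLp f 2 P) :
    ∫⁻ ω, ‖f ω‖ₑ ^ 2 ∂P = ENNReal.ofReal (∫ ω, ‖f ω‖ ^ 2 ∂P) := by
  rw [ofReal_integral_eq_lintegral_ofReal (hf.integrable_norm_pow two_ne_zero)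
    (ae_of_all _ fun ω => by positivity)]
  simp [ENNReal.ofReal_pow]

theorem memLp_two_of_lintegral_enorm_sq_ne_top {f : Ω → 𝕜} (hf : AEStronglyMeasurable f P)
    (h : ∫⁻ ω, ‖f ω‖ₑ ^ 2 ∂P ≠ ∞) : MemLp f 2 P := by
  refine ⟨hf, ?_⟩
  rw [eLpNorm_lt_top_iff_lintegral_rpow_enorm_lt_top two_ne_zero ENNReal.ofNat_ne_top]
  simpa using h.lt_top

/-- Pythagoras' theorem in `L²`. -/
theorem lintegral_enorm_add_sq {f g : Ω → 𝕜} (hf : MemLp f 2 P) (hg : MemLp g 2 P)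
    (h : ∫ ω, f ω * star (g ω) ∂P = 0) :
    ∫⁻ ω, ‖f ω + g ω‖ₑ ^ 2 ∂P = ∫⁻ ω, ‖f ω‖ₑ ^ 2 ∂P + ∫⁻ ω, ‖g ω‖ₑ ^ 2 ∂P := by
  have hfg : Integrable (fun ω => f ω * star (g ω)) P := hf.integrable_mul hg.star
  have hf2 : Integrable (fun ω => ‖f ω‖ ^ 2) P := hf.integrable_norm_pow two_ne_zero
  have hg2 : Integrable (fun ω => ‖g ω‖ ^ 2) P := hg.integrable_norm_pow two_ne_zero
  have hadd : MemLp (fun ω => f ω + g ω) 2 P := hf.add hg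
  rw [lintegral_enorm_sq_eq_ofReal hadd, lintegral_enorm_sq_eq_ofReal hf,
    lintegral_enorm_sq_eq_ofReal hg, ← ENNReal.ofReal_add (integral_nonneg fun ω => by positivity)
      (integral_nonneg fun ω => by positivity)]
  congr 1
  have hexp (ω : Ω) : ‖f ω + g ω‖ ^ 2 =
      ‖f ω‖ ^ 2 + ‖g ω‖ ^ 2 + 2 * RCLike.re (f ω * star (g ω)) := by
    rw [norm_add_pow_two (𝕜 := 𝕜) (f ω) (g ω), RCLike.inner_apply,
      ← RCLike.conj_re (g ω * _)]
    simp only [map_mul, RCLike.conj_conj, RCLike.star_def, mul_comm]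
    ring
  have hfg2 : Integrable (fun ω => ‖f ω‖ ^ 2 + ‖g ω‖ ^ 2) P := hf2.add hg2
  simp_rw [hexp]
  rw [integral_add hfg2 (hfg.re.const_mul 2), integral_add hf2 hg2, integral_const_mul,
    integral_re hfg, h]
  simp

variable {R : Type*} [MeasurableSpace R] {ρ : Measure R} [IsProbabilityMeasure ρ]

/-- If the conditional mean of `V` given the first coordinate is the first coordinate, then the
variance of `V` is the sum of its mean squared distance to the first coordinate and of the variance
of the first coordinate. -/
theorem lintegral_prod_enorm_sub_sq {κ : Measure 𝕜} [IsProbabilityMeasure κ] (hκ : MemLp id 2 κ)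
    {V : 𝕜 × R → 𝕜} (hV : MemLp V 2 (κ.prod ρ)) (h : ∀ᵐ t ∂κ, ∫ r, V (t, r) ∂ρ = t) (m : 𝕜) :
    ∫⁻ p, ‖V p - m‖ₑ ^ 2 ∂(κ.prod ρ) =
      ∫⁻ p, ‖V p - p.1‖ₑ ^ 2 ∂(κ.prod ρ) + ∫⁻ p, ‖p.1 - m‖ₑ ^ 2 ∂(κ.prod ρ) := by
  have h1 : MemLp (fun p : 𝕜 × R => p.1) 2 (κ.prod ρ) :=
    hκ.comp_measurePreserving measurePreserving_fst
  have hf : MemLp (fun p => V p - p.1) 2 (κ.prod ρ) := hV.sub h1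
  have hg : MemLp (fun p : 𝕜 × R => p.1 - m) 2 (κ.prod ρ) := h1.sub (memLp_const m)
  rw [← lintegral_enorm_add_sq hf hg]
  · simp
  · have hinteg : Integrable (fun p => (V p - p.1) * star (p.1 - m)) (κ.prod ρ) :=
      hf.integrable_mul hg.star
    rw [integral_prod _ hinteg]
    refine integral_eq_zero_of_ae ?_
    filter_upwards [h, (hV.integrable one_le_two).prod_right_ae] with t ht hVt
    simp only [Pi.zero_apply]
    rw [integral_mul_const, integral_sub hVt (integrable_const t), ht]
    simp

end Pythagoras

/-! ### Completeness, sufficiency and Lehmann–Scheffé in a location model -/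

section LocationModel

variable {𝕜 E R Y : Type*} [RCLike 𝕜] [AddCommGroup E] [Module 𝕜 E] [MeasurableSpace R]
  [MeasurableSpace Y]

/-- Under the parameter `x` the observation is a function, depending on the nuisance parameter `η x`
alone, of the statistic `T`, whose law is that of `ψ x + τ` for `τ ∼ ν`, and of an independent
variable of law `ρ`. -/
structure IsLocationModel (ν : Measure 𝕜) (ρ : Measure R) (ψ : E →ₗ[𝕜] 𝕜)
    (η : E →ₗ[𝕜] LinearMap.ker ψ) (Φ : LinearMap.ker ψ → 𝕜 × R → Y) (P : E → Measure Y)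
    (T : Y → 𝕜) : Prop where
  bijective : Function.Bijective fun x => (ψ x, η x)
  measurable_stat : Measurable T
  measurable_fun : ∀ h, Measurable (Φ h)
  stat_apply : ∀ h, ∀ᵐ r ∂ρ, ∀ t, T (Φ h (t, r)) = t
  law : ∀ x, P x = ((ν.map fun t => ψ x + t).prod ρ).map (Φ (η x))

namespace IsLocationModel

variable {ν : Measure 𝕜} {ρ : Measure R}
  {ψ : E →ₗ[𝕜] 𝕜} {η : E →ₗ[𝕜] LinearMap.ker ψ} {Φ : LinearMap.ker ψ → 𝕜 × R → Y}
  {P : E → Measure Y} {T : Y → 𝕜}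

theorem exists_eq (hM : IsLocationModel ν ρ ψ η Φ P T) (m : 𝕜) (h : LinearMap.ker ψ) :
    ∃ x, ψ x = m ∧ η x = h := by
  obtain ⟨x, hx⟩ := hM.bijective.2 (m, h)
  exact ⟨x, congrArg Prod.fst hx, congrArg Prod.snd hx⟩

theorem ae_stat_eq_fst (hM : IsLocationModel ν ρ ψ η Φ P T) (h : LinearMap.ker ψ) (κ : Measure 𝕜)
    [SFinite κ] : ∀ᵐ p ∂(κ.prod ρ), T (Φ h p) = p.1 := by
  filter_upwards [Measure.quasiMeasurePreserving_snd.ae (hM.stat_apply h)] with p hp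
  exact hp p.1

variable [IsProbabilityMeasure ρ]

instance isProbabilityMeasure_translate [IsProbabilityMeasure ν] (m : 𝕜) :
    IsProbabilityMeasure (ν.map fun t => m + t) :=
  Measure.isProbabilityMeasure_map (by fun_prop)

theorem map_stat [IsProbabilityMeasure ν] (hM : IsLocationModel ν ρ ψ η Φ P T) (x : E) :
    (P x).map T = ν.map fun t => ψ x + t := by
  rw [hM.law, Measure.map_map hM.measurable_stat (hM.measurable_fun _),
    Measure.map_congr (f := T ∘ Φ (η x)) (g := Prod.fst) (hM.ae_stat_eq_fst _ _)]
  exact measurePreserving_fst.map_eq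

/-- Given `T = t`, the observation is `Φ h (t, r)` with `r ∼ ρ` independent of `t`; this conditional
law involves the parameter only through `h`. -/
theorem isSufficientFor [IsProbabilityMeasure ν] (hM : IsLocationModel ν ρ ψ η Φ P T) :
    IsSufficientFor P ψ T := by
  refine ⟨fun x x' h => by rw [hM.map_stat, hM.map_stat, h], η, hM.bijective, fun h => ?_⟩
  have hmeas := hM.measurable_fun h
  refine ⟨(Kernel.id ×ₖ Kernel.const 𝕜 ρ).map (Φ h), Kernel.IsMarkovKernel.map _ hmeas, ?_⟩
  rintro ⟨x, rfl⟩
  simp only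
  rw [hM.map_stat]
  have hmT := hM.measurable_stat
  ext s hs
  rw [Measure.map_apply (by fun_prop) hs, hM.law, Measure.map_apply hmeas (by measurability),
    Measure.compProd_apply hs]
  have hae : (Φ (η x) ⁻¹' ((fun y => (T y, y)) ⁻¹' s) : Set (𝕜 × R)) =ᵐ[
      (ν.map fun t => ψ x + t).prod ρ] {p | (p.1, Φ (η x) p) ∈ s} := by
    filter_upwards [hM.ae_stat_eq_fst (η x) (ν.map fun t => ψ x + t)] with p hp
    change (((T (Φ (η x) p), Φ (η x) p) ∈ s) = ((p.1, Φ (η x) p) ∈ s))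
    rw [hp]
  have hset : MeasurableSet {p : 𝕜 × R | (p.1, Φ (η x) p) ∈ s} :=
    (measurable_fst.prodMk hmeas) hs
  rw [measure_congr hae, Measure.prod_apply hset]
  refine lintegral_congr fun t => ?_
  rw [Kernel.map_apply' _ hmeas _ (measurable_prodMk_left hs), Kernel.prod_apply, Kernel.id_apply,
    Kernel.const_apply, Measure.dirac_prod, Measure.map_apply measurable_prodMk_left
      (hmeas (measurable_prodMk_left hs))]
  rfl

variable [IsGaussian ν]

theorem isCompleteStatistic (hM : IsLocationModel ν ρ ψ η Φ P T) (hν : ∫ t, t ∂ν = 0) :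
    IsCompleteStatistic 𝕜 P T := by
  intro g hg hinteg h0 x
  have hmT := hM.measurable_stat
  refine ae_of_ae_map hmT.aemeasurable (p := fun t => g t = 0) ?_
  rw [hM.map_stat]
  refine ae_eq_zero_of_integral_translates hν hg (fun m => ?_) (fun m => ?_) (ψ x)
  · obtain ⟨x, rfl, -⟩ := hM.exists_eq m 0
    rw [← hM.map_stat, integrable_map_measure (by fun_prop) (by fun_prop)]
    exact hinteg x
  · obtain ⟨x, rfl, -⟩ := hM.exists_eq m 0
    rw [← hM.map_stat, integral_map (by fun_prop) (by fun_prop)]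
    exact h0 x

theorem memLp_id_translate (ν : Measure 𝕜) [IsGaussian ν] (m : 𝕜) :
    MemLp id 2 (ν.map fun t => m + t) := by
  rw [memLp_map_measure_iff (by fun_prop) (by fun_prop)]
  exact (memLp_const m).add IsGaussian.memLp_two_id

theorem integral_id_translate (hν : ∫ t, t ∂ν = 0) (m : 𝕜) :
    ∫ t, t ∂(ν.map fun t => m + t) = m := by
  have hid : Integrable (fun t : 𝕜 => t) ν := IsGaussian.integrable_id
  rw [integral_map (by fun_prop) (by fun_prop), integral_add (integrable_const m) hid, hν]
  simp

theorem isUnbiased (hM : IsLocationModel ν ρ ψ η Φ P T) (hν : ∫ t, t ∂ν = 0) :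
    IsUnbiased P ψ T := by
  have hmT := hM.measurable_stat
  refine ⟨hmT, fun x => ⟨?_, ?_⟩⟩
  · have h := (memLp_id_translate ν (ψ x)).integrable one_le_two
    rwa [← hM.map_stat, integrable_map_measure (by fun_prop) (by fun_prop)] at h
  · have h := integral_id_translate hν (ψ x)
    rwa [← hM.map_stat, integral_map (by fun_prop) (by fun_prop)] at h

/-- Conditioning an unbiased estimator on the complete sufficient statistic gives the statistic. -/
theorem ae_integral_eq (hM : IsLocationModel ν ρ ψ η Φ P T) (hν : ∫ t, t ∂ν = 0) {U : Y → 𝕜}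
    (hU : IsUnbiased P ψ U) (x : E) :
    ∀ᵐ t ∂(ν.map fun t => ψ x + t), ∫ r, U (Φ (η x) (t, r)) ∂ρ = t := by
  have hmU := hU.1
  have hmeas := hM.measurable_fun (η x)
  have hmV : Measurable fun p => U (Φ (η x) p) := hmU.comp hmeas
  have hg : Measurable fun t => ∫ r, U (Φ (η x) (t, r)) ∂ρ :=
    (hmV.stronglyMeasurable.integral_prod_right' (ν := ρ)).measurable
  have key (m : 𝕜) : Integrable (fun p => U (Φ (η x) p)) ((ν.map fun t => m + t).prod ρ) ∧
      ∫ p, U (Φ (η x) p) ∂((ν.map fun t => m + t).prod ρ) = m := by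
    -- Varying `ψ` with `η` held at `η x` already yields all translates of `ν`, so completeness
    -- applies within one nuisance fiber.
    obtain ⟨x', rfl, h⟩ := hM.exists_eq m (η x)
    have h1 := hU.2 x'
    rw [hM.law, h, integrable_map_measure (by fun_prop) (by fun_prop),
      integral_map (by fun_prop) (by fun_prop)] at h1
    exact h1
  have hid (m : 𝕜) : Integrable (fun t : 𝕜 => t) (ν.map fun t => m + t) :=
    (memLp_id_translate ν m).integrable one_le_two
  have := ae_eq_zero_of_integral_translates hν
    (g := fun t => (∫ r, U (Φ (η x) (t, r)) ∂ρ) - t) (hg.sub measurable_id)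
    (fun m => (key m).1.integral_prod_left.sub (hid m)) (fun m => by
      rw [integral_sub (key m).1.integral_prod_left (hid m), integral_id_translate hν,
        ← integral_prod _ (key m).1, (key m).2, sub_self]) (ψ x)
  filter_upwards [this] with t ht
  exact sub_eq_zero.mp ht

/-- Given `T`, the estimator `U` has conditional mean `T`, so `U - T` is orthogonal to functions of
`T` and Pythagoras applies. -/
theorem eVar_eq_add (hM : IsLocationModel ν ρ ψ η Φ P T) (hν : ∫ t, t ∂ν = 0) {U : Y → 𝕜}
    (hU : IsUnbiased P ψ U) (x : E) (hfin : eVar U (P x) ≠ ∞) :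
    eVar U (P x) = ∫⁻ y, ‖U y - T y‖ₑ ^ 2 ∂(P x) + eVar T (P x) := by
  have hmU := hU.1
  have hmT := hM.measurable_stat
  have hmeas := hM.measurable_fun (η x)
  have hT := hM.isUnbiased hν
  rw [eVar, (hU.2 x).2, hM.law, lintegral_map (by fun_prop) hmeas] at hfin ⊢
  rw [eVar, ← hM.law, (hT.2 x).2, hM.law, lintegral_map (by fun_prop) hmeas,
    lintegral_map (by fun_prop) hmeas]
  have hae := hM.ae_stat_eq_fst (η x) (ν.map fun t => ψ x + t)
  have hV : MemLp (fun p => U (Φ (η x) p)) 2 ((ν.map fun t => ψ x + t).prod ρ) := by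
    have := (memLp_two_of_lintegral_enorm_sq_ne_top
      ((hmU.comp hmeas).sub_const (ψ x)).aestronglyMeasurable hfin).add (memLp_const (ψ x))
    exact this.congr_norm (hmU.comp hmeas).aestronglyMeasurable (ae_of_all _ fun p => by simp)
  rw [lintegral_prod_enorm_sub_sq (memLp_id_translate ν (ψ x)) hV (hM.ae_integral_eq hν hU x)]
  congr 1 <;> refine lintegral_congr_ae ?_ <;> filter_upwards [hae] with p hp <;> rw [hp]

theorem isMVUE (hM : IsLocationModel ν ρ ψ η Φ P T) (hν : ∫ t, t ∂ν = 0) : IsMVUE P ψ T := by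
  refine ⟨hM.isUnbiased hν, fun U hU x => ?_⟩
  by_cases hfin : eVar U (P x) = ∞
  · rw [hfin]
    exact le_top
  · rw [hM.eVar_eq_add hν hU x hfin]
    exact le_add_self

theorem eVar_stat_ne_top (hM : IsLocationModel ν ρ ψ η Φ P T) (hν : ∫ t, t ∂ν = 0) (x : E) :
    eVar T (P x) ≠ ∞ := by
  have hmT := hM.measurable_stat
  have h : MemLp (fun t : 𝕜 => t - ψ x) 2 (ν.map fun t => ψ x + t) :=
    (memLp_id_translate ν (ψ x)).sub (memLp_const _)
  rw [eVar, ((hM.isUnbiased hν).2 x).2,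
    ← lintegral_map (f := fun t => ‖t - ψ x‖ₑ ^ 2) (by fun_prop) hmT, hM.map_stat,
    lintegral_enorm_sq_eq_ofReal h]
  exact ENNReal.ofReal_ne_top

/-- Since `T` has finite variance, equal variances force the excess term `E |U - T|²` to vanish. -/
theorem ae_eq_of_isMVUE (hM : IsLocationModel ν ρ ψ η Φ P T) (hν : ∫ t, t ∂ν = 0) {U : Y → 𝕜}
    (hU : IsMVUE P ψ U) (x : E) : U =ᵐ[P x] T := by
  have hmU := hU.1.1
  have hmT := hM.measurable_stat
  have hfin := hM.eVar_stat_ne_top hν x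
  have hle := hU.2 T (hM.isUnbiased hν) x
  rw [hM.eVar_eq_add hν hU.1 x (hle.trans_lt hfin.lt_top).ne] at hle
  have h0 : ∫⁻ y, ‖U y - T y‖ₑ ^ 2 ∂(P x) = 0 := by
    by_contra hne
    exact absurd hle (not_le.mpr (by simpa [add_comm] using ENNReal.lt_add_right hfin hne))
  rw [lintegral_eq_zero_iff (by fun_prop)] at h0
  filter_upwards [h0] with y hy
  simpa [sub_eq_zero] using hy

end IsLocationModel

end LocationModel

/-! ### The regression model as a location model -/

section Regression

variable {𝕜 : Type*} [RCLike 𝕜] {N n : ℕ} {A : Matrix (Fin N) (Fin n) 𝕜} {w : Fin n → 𝕜}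
  {μ : Measure (Fin N → 𝕜)} {I : Finset (Fin N)} {l : Fin N → 𝕜}

theorem target_apply (w x : Fin n → 𝕜) : target w x = w ⬝ᵥ x := rfl

theorem sum_coe_mul_eq_dotProduct (hl : ∀ i ∉ I, l i = 0) (u : Fin N → 𝕜) :
    ∑ i : I, l i * u i = l ⬝ᵥ u := by
  rw [Finset.sum_coe_sort I fun i => l i * u i]
  exact Finset.sum_subset (Finset.subset_univ I) fun i _ hi => by rw [hl i hi, zero_mul]

/-- There is a direction `v` with `⟨w, v⟩ = 1` in which the noise in the rows in `I` varies with its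
evaluation at `l`: after subtraction of that part, it is uncorrelated with the evaluation. -/
theorem exists_regression_direction [IsGaussian μ] (hw : w ≠ 0) (hl : ∀ i ∉ I, l i = 0)
    (hlA : l ᵥ* A = w)
    (horth : ∀ z : Fin N → 𝕜, (∀ i ∉ I, z i = 0) → z ᵥ* A = 0 →
      ∫ e, star (l ⬝ᵥ e) * (z ⬝ᵥ e) ∂μ = 0) :
    ∃ v, w ⬝ᵥ v = 1 ∧
      ∀ i ∈ I, ∫ e, star (l ⬝ᵥ e) * (e i - (A *ᵥ v) i * (l ⬝ᵥ e)) ∂μ = 0 := by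
  classical
  let σ : 𝕜 := ∫ e, star (l ⬝ᵥ e) * (l ⬝ᵥ e) ∂μ
  by_cases hσ : σ = 0
  -- With zero variance the evaluation vanishes almost surely, and any `v` with `⟨w, v⟩ = 1` will
  -- do.
  · have hz : ∀ᵐ e ∂μ, l ⬝ᵥ e = 0 := by
      have h0 : noiseEval μ l = 0 := by
        rwa [← inner_self_eq_zero (𝕜 := 𝕜), inner_noiseEval_eq_integral]
      filter_upwards [coeFn_noiseEval (μ := μ) l, Lp.coeFn_zero 𝕜 2 μ] with e h1 h2
      rw [← h1, h0, h2, Pi.zero_apply]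
    obtain ⟨j, hj⟩ := Function.ne_iff.mp hw
    refine ⟨Pi.single j (w j)⁻¹, ?_, fun i _ => integral_eq_zero_of_ae ?_⟩
    · rw [dotProduct_single]
      exact mul_inv_cancel₀ hj
    · filter_upwards [hz] with e he
      simp [he]
  · let q : Fin N → 𝕜 := fun i => ∫ e, star (l ⬝ᵥ e) * e i ∂μ
    have hl2 : MemLp (fun e => star (l ⬝ᵥ e)) 2 μ := (memLp_two_dotProduct l).star
    have hqi (i : Fin N) : Integrable (fun e => star (l ⬝ᵥ e) * e i) μ :=
      hl2.integrable_mul (memLp_two_eval i)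
    have hq (z : Fin N → 𝕜) : z ⬝ᵥ q = ∫ e, star (l ⬝ᵥ e) * (z ⬝ᵥ e) ∂μ := by
      have (e : Fin N → 𝕜) : star (l ⬝ᵥ e) * (z ⬝ᵥ e) = ∑ i, z i * (star (l ⬝ᵥ e) * e i) := by
        rw [dotProduct.eq_def z, Finset.mul_sum]
        exact Finset.sum_congr rfl fun i _ => mul_left_comm _ _ _
      simp_rw [this]
      rw [integral_finsetSum _ fun i _ => (hqi i).const_mul (z i)]
      simp only [integral_const_mul]
      rfl
    obtain ⟨v, hv⟩ := exists_mulVec_eq_of_forall_dotProduct_eq_zero A I q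
      fun z hz hzA => by rw [hq, horth z hz hzA]
    -- These are the regression coefficients `q / σ`; the normalization holds because `⟨w, v⟩ = l A
    -- v = l ⬝ᵥ q = σ`.
    refine ⟨σ⁻¹ • v, ?_, fun i hi => ?_⟩
    · have hwv : w ⬝ᵥ v = σ := by
        rw [← hlA, ← Matrix.dotProduct_mulVec, ← sum_coe_mul_eq_dotProduct hl]
        refine Eq.trans ?_ (hq l)
        rw [← sum_coe_mul_eq_dotProduct hl]
        exact Finset.sum_congr rfl fun i _ => by rw [hv i i.2]
      rw [dotProduct_smul, hwv, smul_eq_mul, inv_mul_cancel₀ hσ]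
    · have hσi : Integrable (fun e => star (l ⬝ᵥ e) * (l ⬝ᵥ e)) μ :=
        hl2.integrable_mul (memLp_two_dotProduct l)
      simp_rw [mul_sub, mul_left_comm (star _)]
      rw [integral_sub (hqi i) (hσi.const_mul _), integral_const_mul, Matrix.mulVec_smul,
        Pi.smul_apply, hv i hi, smul_eq_mul]
      change q i - σ⁻¹ * q i * σ = 0
      field_simp
      ring

/-- The component of `x` in `ker ⟨w, ·⟩` along `v`. -/
def nuisance (w v : Fin n → 𝕜) (hv : w ⬝ᵥ v = 1) : (Fin n → 𝕜) →ₗ[𝕜] LinearMap.ker (target w) :=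
  LinearMap.codRestrict _ (LinearMap.id - (target w).smulRight v) fun x => by
    simp [target_apply, dotProduct_sub, dotProduct_smul, hv]

theorem nuisance_apply (w v : Fin n → 𝕜) (hv : w ⬝ᵥ v = 1) (x : Fin n → 𝕜) :
    (nuisance w v hv x : Fin n → 𝕜) = x - (w ⬝ᵥ x) • v := rfl

theorem bijective_target_nuisance (w v : Fin n → 𝕜) (hv : w ⬝ᵥ v = 1) :
    Function.Bijective fun x => (target w x, nuisance w v hv x) := by
  refine ⟨fun x y h => ?_, fun ⟨m, h⟩ => ⟨h + m • v, ?_⟩⟩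
  · have h1 : w ⬝ᵥ x = w ⬝ᵥ y := congrArg Prod.fst h
    have h2 := congrArg (fun p => (p.2 : Fin n → 𝕜)) h
    simp only [nuisance_apply, h1] at h2
    simpa using h2
  · have hh : w ⬝ᵥ (h : Fin n → 𝕜) = 0 := h.2
    have h1 : w ⬝ᵥ ((h : Fin n → 𝕜) + m • v) = m := by
      rw [dotProduct_add, dotProduct_smul, hh, hv, zero_add, smul_eq_mul, mul_one]
    refine Prod.ext h1 (Subtype.ext ?_)
    rw [nuisance_apply, h1, add_sub_cancel_right]

/-- The observations in terms of the nuisance parameter, the estimator, and the residual. -/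
def reconstruct (A : Matrix (Fin N) (Fin n) 𝕜) (I : Finset (Fin N)) (v h : Fin n → 𝕜)
    (p : 𝕜 × (I → 𝕜)) : I → 𝕜 :=
  fun i => (A *ᵥ h) i + p.1 * (A *ᵥ v) i + p.2 i

theorem measurable_reconstruct (A : Matrix (Fin N) (Fin n) 𝕜) (I : Finset (Fin N))
    (v h : Fin n → 𝕜) : Measurable (reconstruct A I v h) := by
  unfold reconstruct
  fun_prop

theorem measurable_estimator (D : Divisor A w) : Measurable (estimator I D) := by
  unfold estimator
  fun_prop

/-- The regression model is a location model for the estimator. -/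
theorem isLocationModel (hμ : IsGaussianNoise μ) {D : Divisor A w}
    (hDI : ∀ i ∉ I, divisorVector D i = 0) (hDA : divisorVector D ᵥ* A = w) {v : Fin n → 𝕜}
    (hv : w ⬝ᵥ v = 1)
    (hc : ∀ i ∈ I, ∫ e, star (divisorVector D ⬝ᵥ e) *
      (e i - (A *ᵥ v) i * (divisorVector D ⬝ᵥ e)) ∂μ = 0) :
    IsLocationModel (μ.map fun e => divisorVector D ⬝ᵥ e)
      (μ.map (residual I (divisorVector D) (A *ᵥ v))) (target w) (nuisance w v hv)
      (fun h => reconstruct A I v h) (observationLaw A μ I) (estimator I D) where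
  bijective := bijective_target_nuisance w v hv
  measurable_stat := measurable_estimator D
  measurable_fun h := measurable_reconstruct A I v h
  stat_apply h := by
    set l := divisorVector D with hl
    have hA (x : Fin n → 𝕜) : l ⬝ᵥ (A *ᵥ x) = w ⬝ᵥ x := by rw [Matrix.dotProduct_mulVec, hDA]
    -- The estimator kills the residual: `l ⬝ᵥ e - (l ⬝ᵥ e) ⟨w, v⟩ = 0`.
    have hr : ∀ᵐ r ∂(μ.map (residual I l (A *ᵥ v))), ∑ i : I, l i * r i = 0 := by
      refine (ae_map_iff (continuous_residual I l _).measurable.aemeasurable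
        (measurableSet_eq_fun (by fun_prop) measurable_const)).mpr (ae_of_all _ fun e => ?_)
      have := sum_coe_mul_eq_dotProduct hDI (e - (l ⬝ᵥ e) • (A *ᵥ v))
      rw [dotProduct_sub, dotProduct_smul, hA, hv, smul_eq_mul, mul_one, sub_self] at this
      rw [← this]
      exact Finset.sum_congr rfl fun i _ => by simp [residual, mul_comm]
    filter_upwards [hr] with r hr t
    have hh : w ⬝ᵥ (h : Fin n → 𝕜) = 0 := h.2
    have := sum_coe_mul_eq_dotProduct hDI (A *ᵥ (h : Fin n → 𝕜) + t • (A *ᵥ v))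
    rw [dotProduct_add, dotProduct_smul, hA, hA, hv, hh, zero_add, smul_eq_mul,
      mul_one] at this
    simp only [estimator, reconstruct, ← hl, mul_add, Finset.sum_add_distrib, hr, add_zero]
    rw [← Finset.sum_add_distrib]
    refine Eq.trans (Finset.sum_congr rfl fun i _ => ?_) this
    simp [mul_add]
  law x := by
    have := hμ.gaussian
    set l := divisorVector D
    have hml : Measurable fun e : Fin N → 𝕜 => l ⬝ᵥ e := (continuous_dotProduct_left l).measurable
    have hmr : Measurable (residual I l (A *ᵥ v)) := (continuous_residual I l _).measurable
    have hind := (indepFun_iff_map_prod_eq_prod_map_map hml.aemeasurable hmr.aemeasurable).mp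
      (hμ.indepFun_residual hc)
    have : IsProbabilityMeasure (μ.map fun e => l ⬝ᵥ e) :=
      Measure.isProbabilityMeasure_map hml.aemeasurable
    have : IsProbabilityMeasure (μ.map (residual I l (A *ᵥ v))) :=
      Measure.isProbabilityMeasure_map hmr.aemeasurable
    have hprod := Measure.map_prod_map (μ.map fun e => l ⬝ᵥ e) (μ.map (residual I l (A *ᵥ v)))
      (f := fun t => target w x + t) (g := id) (by fun_prop) measurable_id
    rw [Measure.map_id] at hprod
    rw [hprod, ← hind, Measure.map_map (measurable_reconstruct A I v _) (by fun_prop),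
      Measure.map_map ((measurable_reconstruct A I v _).comp (by fun_prop)) (by fun_prop),
      observationLaw]
    congr 1
    -- Substituting `T = ⟨w, x⟩ + l ⬝ᵥ e`, the multiples of `A v` in `η x`, `T` and the residual
    -- cancel, leaving `A x + e`.
    funext e i
    simp only [reconstruct, Function.comp_apply, Prod.map_fst, Prod.map_snd, id, residual,
      nuisance_apply, target_apply, Matrix.mulVec_sub, Matrix.mulVec_smul, Pi.add_apply,
      Pi.sub_apply, Pi.smul_apply, smul_eq_mul]
    ring

end Regression

end MatroidRegression

theorem mainTheorem3 {𝕜 : Type*} [RCLike 𝕜] {N n : ℕ}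
    (A : Matrix (Fin N) (Fin n) 𝕜) (w : Fin n → 𝕜) (hw : w ≠ 0)
    (μ : Measure (Fin N → 𝕜)) (hμ : IsGaussianNoise μ)
    (L : AffineSubspace 𝕜 (Divisor A w)) (hL : IsParticularSystem L)
    (I : Finset (Fin N)) (hI : IsSupport L I) :
    (∃ D, IsKernelMinimizer (noiseCov μ) L D) ∧
    ∀ D, IsKernelMinimizer (noiseCov μ) L D → (∀ i ∉ I, divisorVector D i = 0) →
      IsCompleteStatistic 𝕜 (observationLaw A μ I) (estimator I D) ∧
      IsSufficientFor (observationLaw A μ I) (target w) (estimator I D) ∧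
      IsMVUE (observationLaw A μ I) (target w) (estimator I D) ∧
      ∀ U, IsMVUE (observationLaw A μ I) (target w) U →
        ∀ x, U =ᵐ[observationLaw A μ I x] estimator I D := by
  have := hμ.gaussian
  refine ⟨exists_isKernelMinimizer hL.nonempty, fun D hD hDI => ?_⟩
  have hDA : divisorVector D ᵥ* A = w :=
    (divisorVector_of_mem_particularSystemOn (hL.subset hD.1)).2
  obtain ⟨v, hv, hc⟩ := exists_regression_direction (μ := μ) hw hDI hDA
    fun z hz hzA => hD.integral_star_mul_eq_zero hL hI.prop hDI hz hzA
  have hM := isLocationModel hμ hDI hDA hv hc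
  have hml : Measurable fun e : Fin N → 𝕜 => divisorVector D ⬝ᵥ e :=
    (continuous_dotProduct_left _).measurable
  have : IsProbabilityMeasure (μ.map (residual I (divisorVector D) (A *ᵥ v))) :=
    Measure.isProbabilityMeasure_map (continuous_residual I _ _).measurable.aemeasurable
  have : IsGaussian (μ.map fun e => divisorVector D ⬝ᵥ e) :=
    isGaussian_map
      ((dotProductBilin 𝕜 𝕜 (divisorVector D)).restrictScalars ℝ).toContinuousLinearMap
  have hν : ∫ t, t ∂(μ.map fun e => divisorVector D ⬝ᵥ e) = 0 := by
    rw [integral_map hml.aemeasurable (by fun_prop), hμ.integral_dotProduct]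
  exact ⟨hM.isCompleteStatistic hν, hM.isSufficientFor, hM.isMVUE hν,
    fun U hU x => hM.ae_eq_of_isMVUE hν hU x⟩
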